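/- Let $K$ be a global field (of any characteristic), i.e. a number field or a finite extension of $\mathbb{F}_q(t)$ for some finite field $\mathbb{F}_q$, and let $L/K$ be a finite separable extension. Let $\mathfrak{O}_K$ be a Dedekind domain with field of fractions $K$ (for instance the ring of algebraic integers of $K$ if $K$ is a number field, or the integral closure of $\mathbb{F}_q[t]$ in $K$ if $K$ is a finite separable extension of $\mathbb{F}_q(t)$), and let $\mathfrak{O}_L$ be its integral closure in $L$. Let $H_1, H_2$ be $K$-Hopf algebras giving Hopf-Galois structures on $L/K$; that is, for $i=1,2$, $L$ is an $H_i$-module algebra and the $K$-linear map $j: L\otimes_K H_i \to \mathrm{End}_K(L)$, $j(l\otimes h)(x) = l\,(h\cdot x)$, is bijective. Suppose that the actions commute: $$h_1\cdot(h_2\cdot x) = h_2\cdot(h_1\cdot x)\qquad\text{for all } h_1\in H_1,\ h_2\in H_2,\ x\in L.$$ Let $\mathfrak{B}$ be a fractional ideal of $L$ (with respect to $\mathfrak{O}_L$), and for $i=1,2$ let $\mathfrak{A}_i = \{h\in H_i \mid h\cdot x\in\mathfrak{B} \text{ for all } x\in\mathfrak{B}\}$ be its associated order in $H_i$. Call $\mathfrak{B}$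 a locally free $\mathfrak{A}_i$-module if for every nonzero prime $\mathfrak{p}$ of $\mathfrak{O}_K$, with $\mathfrak{O}_{K,\mathfrak{p}}$ the $\mathfrak{p}$-adic completion of $\mathfrak{O}_K$, the module $\mathfrak{O}_{K,\mathfrak{p}}\otimes_{\mathfrak{O}_K}\mathfrak{B}$ is free over $\mathfrak{O}_{K,\mathfrak{p}}\otimes_{\mathfrak{O}_K}\mathfrak{A}_i$. Then $\mathfrak{B}$ is a locally free $\mathfrak{A}_1$-module if and only if it is a locally free $\mathfrak{A}_2$-module. -/

import Mathlib

open scoped TensorProduct RatFunc nonZeroDivisors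

/-- A global field: an algebraic number field, or a finite extension of the rational function
field in one variable over a finite field. -/
def IsGlobalField (K : Type*) [Field K] : Prop :=
  NumberField K ∨
    ∃ (F : Type) (_ : Field F) (_ : Finite F) (_ : Algebra F⟮X⟯ K), FunctionField F K

section HopfGalois

variable (K L H : Type*) [Field K] [Field L] [Algebra K L] [Ring H] [HopfAlgebra K H]
  [Module H L] [IsScalarTower K H L]

/-- The action map `H → End_K(L)`, `h ↦ (x ↦ h • x)`. -/
def hopfAction : H →ₐ[K] Module.End K L :=
  haveI : SMulCommClass H K L := IsScalarTower.to_smulCommClass'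
  Algebra.lsmul K K L

/-- The canonical map `j : L ⊗_K H → End_K(L)`, `j (l ⊗ h) x = l * (h • x)`. -/
noncomputable def hopfGaloisMap : L ⊗[K] H →ₗ[K] Module.End K L :=
  TensorProduct.lift ((LinearMap.mul K (Module.End K L)).compl₁₂
    (LinearMap.mul K L) (hopfAction K L H).toLinearMap)

@[simp] lemma hopfAction_apply (h : H) (x : L) : hopfAction K L H h x = h • x := rfl

@[simp] lemma hopfGaloisMap_tmul (l : L) (h : H) (x : L) :
    hopfGaloisMap K L H (l ⊗ₜ[K] h) x = l * (h • x) := rfl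

/-- The `K`-Hopf algebra `H`, acting `K`-linearly on `L`, gives a Hopf-Galois structure on `L / K`:
`L` is an `H`-module algebra and the canonical map `j : L ⊗_K H → End_K(L)` is bijective. -/
structure IsHopfGalois : Prop where
  /-- `h • 1 = ε(h) 1` -/
  smul_one : ∀ h : H, h • (1 : L) = algebraMap K L (Coalgebra.counit (R := K) h)
  /-- `h • (x * y) = ∑ (h₍₁₎ • x) * (h₍₂₎ • y)` -/
  smul_mul : ∀ (h : H) (x y : L), h • (x * y) =
    LinearMap.mul' K L (TensorProduct.map
      ((hopfAction K L H).toLinearMap.flip x) ((hopfAction K L H).toLinearMap.flip y)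
      (Coalgebra.comul (R := K) h))
  bijective : Function.Bijective (hopfGaloisMap K L H)

end HopfGalois

section AssociatedOrder

variable (R K : Type*) {L : Type*} (H : Type*) [CommRing R] [Field K] [Field L]
  [Algebra R K] [Algebra K L] [Algebra R L] [IsScalarTower R K L]
  [Ring H] [Algebra K H] [Algebra R H] [IsScalarTower R K H]
  [Module H L] [IsScalarTower K H L]

/-- The associated order `{h ∈ H | h • x ∈ B for all x ∈ B}` of an `R`-submodule `B` of `L`. -/
def associatedOrder (B : Submodule R L) : Subalgebra R H where
  carrier := {h | ∀ x ∈ B, h • x ∈ B}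
  mul_mem' ha hb x hx := by rw [mul_smul]; exact ha _ (hb x hx)
  add_mem' ha hb x hx := by rw [add_smul]; exact B.add_mem (ha x hx) (hb x hx)
  algebraMap_mem' r x hx := by
    have h : algebraMap R H r • x = r • x := by
      rw [IsScalarTower.algebraMap_apply R K H, algebraMap_smul, algebraMap_smul]
    rw [h]
    exact B.smul_mem r hx

/-- `B` is a module over its associated order: the action `𝔄 → End_R(B)`. -/
def associatedOrderAction (B : Submodule R L) :
    associatedOrder R K H B →ₐ[R] Module.End R B where
  toFun a :=
    { toFun := fun x => ⟨(a : H) • (x : L), a.2 x x.2⟩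
      map_add' := fun x y => Subtype.ext (smul_add (a : H) (x : L) (y : L))
      map_smul' := fun r x => Subtype.ext (by
        have : SMulCommClass H K L := IsScalarTower.to_smulCommClass'
        change (a : H) • (r • (x : L)) = r • ((a : H) • (x : L))
        rw [← algebraMap_smul K r (x : L), smul_comm, algebraMap_smul]) }
  map_one' := LinearMap.ext fun x => Subtype.ext (one_smul H (x : L))
  map_mul' a b := LinearMap.ext fun x => Subtype.ext (mul_smul (a : H) (b : H) (x : L))
  map_zero' := LinearMap.ext fun x => Subtype.ext (zero_smul H (x : L))
  map_add' a b := LinearMap.ext fun x => Subtype.ext (add_smul (a : H) (b : H) (x : L))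
  commutes' r := LinearMap.ext fun x => Subtype.ext (by
    change algebraMap R H r • (x : L) = r • (x : L)
    rw [IsScalarTower.algebraMap_apply R K H, algebraMap_smul, algebraMap_smul])

@[simp] lemma associatedOrderAction_apply (B : Submodule R L) (a : associatedOrder R K H B)
    (x : B) : (associatedOrderAction R K H B a x : L) = (a : H) • (x : L) := rfl

end AssociatedOrder

section BaseChange

variable {R : Type*} [CommRing R] (R' : Type*) [CommRing R'] [Algebra R R']
  {A : Type*} [Ring A] [Algebra R A] {M : Type*} [AddCommGroup M] [Module R M]

/-- The base change `R' ⊗_R A → End_{R'}(R' ⊗_R M)` of an action `A → End_R(M)`. -/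
noncomputable def baseChangeAction (f : A →ₐ[R] Module.End R M) :
    R' ⊗[R] A →ₐ[R'] Module.End R' (R' ⊗[R] M) :=
  (LinearMap.tensorProductEnd R R' M).comp (Algebra.TensorProduct.map (AlgHom.id R' R') f)

@[simp] lemma baseChangeAction_tmul (f : A →ₐ[R] Module.End R M) (r s : R') (a : A) (m : M) :
    baseChangeAction R' f (r ⊗ₜ[R] a) (s ⊗ₜ[R] m) = (r * s) ⊗ₜ[R] f a m := by
  change r • (s ⊗ₜ[R] f a m) = _
  rw [TensorProduct.smul_tmul', smul_eq_mul]

/-- `R' ⊗_R M` is a free module over `R' ⊗_R A`, where `A` acts on `M` through `f`. -/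
def IsFreeAfterBaseChange (f : A →ₐ[R] Module.End R M) : Prop :=
  letI : Module (R' ⊗[R] A) (R' ⊗[R] M) :=
    Module.compHom (R' ⊗[R] M) (baseChangeAction R' f).toRingHom
  Module.Free (R' ⊗[R] A) (R' ⊗[R] M)

end BaseChange

/-- `B` is locally free over its associated order `𝔄` in `H`: for every prime `p` of the Dedekind
domain `R`, with completion `R_p`, the `R_p ⊗_R 𝔄`-module `R_p ⊗_R B` is free. -/
def IsLocallyFreeOverAssociatedOrder (R K : Type*) {L : Type*} (H : Type*)
    [CommRing R] [IsDedekindDomain R] [Field K] [Field L]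
    [Algebra R K] [IsFractionRing R K] [Algebra K L] [Algebra R L] [IsScalarTower R K L]
    [Ring H] [Algebra K H] [Algebra R H] [IsScalarTower R K H]
    [Module H L] [IsScalarTower K H L] (B : Submodule R L) : Prop :=
  ∀ p : IsDedekindDomain.HeightOneSpectrum R,
    IsFreeAfterBaseChange (p.adicCompletionIntegers K) (associatedOrderAction R K H B)

/-! Fix a prime, let R' be the completed ring and write 𝔄ᵢ', B' for the base changes. If B' is free
over 𝔄₁', equality of R'-ranks leaves a single basis element x. An endomorphism commuting with 𝔄₁'
is determined by its value at x, and that value can be any y ∈ B'. As 𝔄₂' acts faithfully and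
commutes with 𝔄₁', the map b ↦ b • x on 𝔄₂' is injective; by ranks its cokernel is torsion. So if φ
commutes with 𝔄₁', then r • φ comes from 𝔄₂' for some r ≠ 0. But 𝔄₂' is saturated in End(B'), so φ
itself comes from 𝔄₂', and the same x is a basis over 𝔄₂'. This is
`IsFreeAfterBaseChange.of_commute`; saturation survives base change by
`mem_range_baseChangeAction_of_smul_mem`. -/

/-! ### Ranks of lattices over a domain -/

section DomainRank

variable {R : Type*} [CommRing R] [IsDomain R]

/-- An injective linear map between modules of the same positive finite rank over a domain has
torsion cokernel. -/
theorem LinearMap.exists_smul_mem_range_of_finrank_eq {N M : Type*} [AddCommGroup N] [Module R N]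
    [AddCommGroup M] [Module R M] (g : N →ₗ[R] M) (hg : Function.Injective g)
    (h : Module.finrank R N = Module.finrank R M) (h0 : 0 < Module.finrank R M) (m : M) :
    ∃ r : R, r ≠ 0 ∧ ∃ n, g n = r • m := by
  have e := (LinearEquiv.ofInjective g hg).finrank_eq
  -- Positivity rules out the default value 0 that `finrank` takes at infinite rank; finite
  -- cardinals can then be cancelled.
  have hM : Module.rank R M = Module.finrank R M :=
    (Cardinal.cast_toNat_of_lt_aleph0 (Cardinal.toNat_pos.mp h0).2).symm
  have hg' : Module.rank R (LinearMap.range g) = Module.finrank R M := by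
    rw [← h, e]
    exact (Cardinal.cast_toNat_of_lt_aleph0 (Cardinal.toNat_pos.mp (h0.trans_eq (h.symm.trans e))).2).symm
  have hq := rank_quotient_add_rank_of_isDomain (LinearMap.range g)
  rw [hg', hM] at hq
  replace hq := hq.trans (zero_add _).symm
  obtain ⟨r, hr, hm⟩ := rank_eq_zero_iff.mp
    (Cardinal.eq_of_add_eq_add_right hq (Cardinal.natCast_lt_aleph0))
    (Submodule.Quotient.mk m : M ⧸ LinearMap.range g)
  rw [← Submodule.Quotient.mk_smul, Submodule.Quotient.mk_eq_zero] at hm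
  exact ⟨r, hr, hm⟩

/-- A full `R`-lattice in a vector space over the fraction field has the expected rank. -/
theorem Submodule.finrank_eq_of_forall_exists_smul_mem (K : Type*) [Field K] [Algebra R K]
    [IsFractionRing R K] {V : Type*} [AddCommGroup V] [Module K V] [Module R V]
    [IsScalarTower R K V] (N : Submodule R V) (h : ∀ v : V, ∃ r : R, r ≠ 0 ∧ r • v ∈ N) :
    Module.finrank R N = Module.finrank K V := by
  have hu (r : R⁰) : IsUnit (algebraMap R (Module.End R V) r) := by
    have hr : algebraMap R K r ≠ 0 := IsFractionRing.to_map_ne_zero_of_mem_nonZeroDivisors r.2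
    rw [Module.End.isUnit_iff]
    constructor
    · intro x y hxy
      simp only [Module.algebraMap_end_apply, ← algebraMap_smul K (r : R)] at hxy
      exact smul_right_injective V hr hxy
    · intro y
      refine ⟨(algebraMap R K r)⁻¹ • y, ?_⟩
      rw [Module.algebraMap_end_apply, ← algebraMap_smul K (r : R), smul_inv_smul₀ hr]
  -- Fullness says that V is N localized at the nonzero elements of R.
  have : IsLocalizedModule R⁰ N.subtype :=
    { map_units := hu
      surj := fun v => by
        obtain ⟨r, hr, hv⟩ := h v
        exact ⟨⟨⟨r • v, hv⟩, ⟨r, mem_nonZeroDivisors_of_ne_zero hr⟩⟩, rfl⟩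
      exists_of_eq := fun {x y} hxy => ⟨1, by rw [Subtype.ext hxy]⟩ }
  rw [IsFractionRing.finrank_right_eq R K V]
  exact (IsLocalizedModule.finrank_eq R⁰ N.subtype le_rfl).symm

end DomainRank

/-! ### Flat base change of an action -/

section BaseChangeAction

variable {R : Type*} [CommRing R] (R' : Type*) [CommRing R'] [Algebra R R']
  {A : Type*} [Ring A] [Algebra R A] {M : Type*} [AddCommGroup M] [Module R M]

/-- Hom out of a finitely presented module commutes with flat base change. -/
theorem LinearMap.tensorProductEnd_bijective [Module.Flat R R'] [Module.FinitePresentation R M] :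
    Function.Bijective (LinearMap.tensorProductEnd R R' M) := by
  have h := Module.FinitePresentation.isBaseChange_map R M M R'
  convert h.equiv.bijective using 1
  ext x : 1
  induction x using TensorProduct.induction_on with
  | zero => simp
  | add x y hx hy => rw [map_add, map_add, hx, hy]
  | tmul r f =>
    ext m
    rw [IsBaseChange.equiv_tmul]
    rfl

theorem baseChangeAction_eq (f : A →ₐ[R] Module.End R M) (a : R' ⊗[R] A) :
    baseChangeAction R' f a =
      LinearMap.tensorProductEnd R R' M (f.toLinearMap.lTensor R' a) := by
  induction a using TensorProduct.induction_on with
  | zero => simp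
  | add x y hx hy => simp only [map_add, hx, hy]
  | tmul r f => rfl

theorem baseChangeAction_injective [Module.Flat R R'] [Module.FinitePresentation R M]
    (f : A →ₐ[R] Module.End R M) (hf : Function.Injective f) :
    Function.Injective (baseChangeAction R' f) := by
  have h := (LinearMap.tensorProductEnd_bijective (M := M) R').injective.comp
    (Module.Flat.lTensor_preserves_injective_linearMap (M := R') f.toLinearMap hf)
  intro a b hab
  rw [baseChangeAction_eq, baseChangeAction_eq] at hab
  exact h hab

/-- If `A → End_R(M)` has torsion-free cokernel, so has its flat base change to a domain. -/
theorem mem_range_baseChangeAction_of_smul_mem [IsDedekindDomain R] [IsDomain R']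
    [Module.Flat R R'] [Module.FinitePresentation R M] (f : A →ₐ[R] Module.End R M)
    (hf : ∀ (r : R) (φ : Module.End R M), r ≠ 0 → r • φ ∈ f.range → φ ∈ f.range)
    {r : R'} (hr : r ≠ 0) {φ : Module.End R' (R' ⊗[R] M)}
    (h : r • φ ∈ (baseChangeAction R' f).range) : φ ∈ (baseChangeAction R' f).range := by
  let g := (LinearMap.range f.toLinearMap).mkQ
  -- Torsion-free over a Dedekind domain means flat, so the cokernel stays flat, hence torsion-free,
  -- over R'.
  have hQ : Module.IsTorsionFree R (Module.End R M ⧸ LinearMap.range f.toLinearMap) := by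
    refine .of_smul_eq_zero fun s q hsq => ?_
    induction q using Submodule.Quotient.induction_on with | _ ψ
    by_contra! hc
    rw [← Submodule.Quotient.mk_smul, Submodule.Quotient.mk_eq_zero] at hsq
    exact hc.2 ((Submodule.Quotient.mk_eq_zero _).mpr (hf s ψ hc.1 hsq))
  have hex : Function.Exact (f.toLinearMap.lTensor R') (g.lTensor R') :=
    lTensor_exact R' (LinearMap.exact_map_mkQ_range _) (Submodule.mkQ_surjective _)
  obtain ⟨e, rfl⟩ := (LinearMap.tensorProductEnd_bijective (M := M) R').surjective φ
  obtain ⟨a, ha⟩ := h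
  have ha' : f.toLinearMap.lTensor R' a = r • e := by
    apply (LinearMap.tensorProductEnd_bijective (M := M) R').injective
    rw [map_smul, ← ha, ← baseChangeAction_eq]
    rfl
  have he : r • (g.baseChange R' e) = 0 := by
    rw [← map_smul, ← ha']
    exact hex.apply_apply_eq_zero a
  have he' : g.lTensor R' e = 0 := (smul_eq_zero.mp he).resolve_left hr
  obtain ⟨b, hb⟩ := (hex e).mp he'
  exact ⟨b, by rw [← hb, ← baseChangeAction_eq]; rfl⟩

theorem baseChangeAction_commute {A₂ : Type*} [Ring A₂] [Algebra R A₂]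
    (f : A →ₐ[R] Module.End R M) (f₂ : A₂ →ₐ[R] Module.End R M)
    (h : ∀ a b, Commute (f a) (f₂ b)) (a : R' ⊗[R] A) (b : R' ⊗[R] A₂) :
    Commute (baseChangeAction R' f a) (baseChangeAction R' f₂ b) := by
  induction a using TensorProduct.induction_on with
  | zero => simp
  | add x y hx hy => rw [map_add]; exact hx.add_left hy
  | tmul r a =>
    induction b using TensorProduct.induction_on with
    | zero => simp
    | add x y hx hy => rw [map_add]; exact hx.add_right hy
    | tmul s b =>
      refine TensorProduct.AlgebraTensorModule.curry_injective
        (LinearMap.ext fun t => LinearMap.ext fun m => ?_)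
      have := LinearMap.congr_fun (h a b) m
      simp only [Module.End.mul_apply] at this
      simp [this, mul_left_comm]

/-- Freeness over a base-changed algebra passes to a saturated algebra of commuting endomorphisms
of the same rank. -/
theorem IsFreeAfterBaseChange.of_commute [IsDedekindDomain R] [IsDomain R'] [FaithfulSMul R R']
    [Module.Flat R R'] [Module.FinitePresentation R M] {A₂ : Type*} [Ring A₂] [Algebra R A₂]
    {f : A →ₐ[R] Module.End R M} {f₂ : A₂ →ₐ[R] Module.End R M}
    (hcomm : ∀ a b, Commute (f a) (f₂ b)) (hf₂ : Function.Injective f₂)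
    (hsat : ∀ (r : R) (φ : Module.End R M), r ≠ 0 → r • φ ∈ f₂.range → φ ∈ f₂.range)
    (hA : Module.finrank R A = Module.finrank R M)
    (hA₂ : Module.finrank R A₂ = Module.finrank R M) (hM : 0 < Module.finrank R M)
    (h : IsFreeAfterBaseChange R' f) : IsFreeAfterBaseChange R' f₂ := by
  have rkA : Module.finrank R' (R' ⊗[R] A) = Module.finrank R A :=
    (TensorProduct.isBaseChange R A R').finrank_eq
  have rkA₂ : Module.finrank R' (R' ⊗[R] A₂) = Module.finrank R A₂ :=
    (TensorProduct.isBaseChange R A₂ R').finrank_eq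
  have rkM : Module.finrank R' (R' ⊗[R] M) = Module.finrank R M :=
    (TensorProduct.isBaseChange R M R').finrank_eq
  have hM' : 0 < Module.finrank R' (R' ⊗[R] M) := rkM ▸ hM
  let m₁ : Module (R' ⊗[R] A) (R' ⊗[R] M) :=
    Module.compHom (R' ⊗[R] M) (baseChangeAction R' f).toRingHom
  have sm₁ (a : R' ⊗[R] A) (x : R' ⊗[R] M) : a • x = baseChangeAction R' f a x := rfl
  have tow₁ : IsScalarTower R' (R' ⊗[R] A) (R' ⊗[R] M) :=
    ⟨fun r a x => by rw [sm₁, sm₁, map_smul]; rfl⟩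
  have fr₁ : Module.Free (R' ⊗[R] A) (R' ⊗[R] M) := h
  let bas := Module.Free.chooseBasis (R' ⊗[R] A) (R' ⊗[R] M)
  have : Nontrivial (R' ⊗[R] M) := Module.nontrivial_of_finrank_pos hM'
  obtain ⟨i⟩ : Nonempty (Module.Free.ChooseBasisIndex (R' ⊗[R] A) (R' ⊗[R] M)) :=
    bas.index_nonempty
  have inj₁ : Function.Injective fun a : R' ⊗[R] A => a • bas i := by
    intro a b hab
    have := congrArg (fun y => bas.repr y i) hab
    simpa using this
  have tors₁ := ((LinearMap.toSpanSingleton (R' ⊗[R] A) (R' ⊗[R] M) (bas i)).restrictScalars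
    R').exists_smul_mem_range_of_finrank_eq inj₁ (by rw [rkA, rkM, hA]) hM'
  -- A second basis vector would have a nonzero multiple r • `bas j` in the span of `bas i`; then r
  -- kills 1 in the algebra, hence all of the module, against positive rank.
  have hi (j) : j = i := by
    by_contra hj
    obtain ⟨r, hr, a, ha⟩ := tors₁ (bas j)
    change a • bas i = r • bas j at ha
    rw [← one_smul (R' ⊗[R] A) (bas j), ← smul_assoc] at ha
    have hr1 : r • (1 : R' ⊗[R] A) = 0 := by
      have := congrArg (fun y => bas.repr y j) ha
      simp only [map_smul (bas.repr), Module.Basis.repr_self, Finsupp.smul_single] at this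
      simpa [Finsupp.single_apply, Ne.symm hj] using this.symm
    have h0 : Module.rank R' (R' ⊗[R] M) = 0 := rank_eq_zero_iff.mpr fun x =>
      ⟨r, hr, by rw [← one_smul (R' ⊗[R] A) x, ← smul_assoc, hr1, zero_smul]⟩
    rw [Module.finrank, h0, map_zero] at hM'
    exact hM'.false
  have surj₁ (y : R' ⊗[R] M) : ∃ a : R' ⊗[R] A, a • bas i = y := by
    refine ⟨bas.repr y i, bas.repr.injective (Finsupp.ext fun j => ?_)⟩
    simp [hi j]
  have comm := baseChangeAction_commute R' f f₂ hcomm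
  have ext₁ (φ ψ : Module.End R' (R' ⊗[R] M)) (hφ : ∀ a, Commute (baseChangeAction R' f a) φ)
      (hψ : ∀ a, Commute (baseChangeAction R' f a) ψ) (hx : φ (bas i) = ψ (bas i)) : φ = ψ := by
    refine LinearMap.ext fun y => ?_
    obtain ⟨a, rfl⟩ := surj₁ y
    have h1 := LinearMap.congr_fun (hφ a) (bas i)
    have h2 := LinearMap.congr_fun (hψ a) (bas i)
    rw [Module.End.mul_apply, Module.End.mul_apply] at h1 h2
    rw [sm₁, ← h1, ← h2, hx]
  let m₂ : Module (R' ⊗[R] A₂) (R' ⊗[R] M) :=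
    Module.compHom (R' ⊗[R] M) (baseChangeAction R' f₂).toRingHom
  have sm₂ (a : R' ⊗[R] A₂) (x : R' ⊗[R] M) : a • x = baseChangeAction R' f₂ a x := rfl
  have tow₂ : IsScalarTower R' (R' ⊗[R] A₂) (R' ⊗[R] M) :=
    ⟨fun r a x => by rw [sm₂, sm₂, map_smul]; rfl⟩
  have inj₂ : Function.Injective fun a : R' ⊗[R] A₂ => a • bas i := fun a b hab =>
    baseChangeAction_injective R' f₂ hf₂ (ext₁ _ _ (comm · a) (comm · b) hab)
  have surj₂ : Function.Surjective fun a : R' ⊗[R] A₂ => a • bas i := by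
    intro y
    -- the endomorphism commuting with `R' ⊗ A` that sends the generator to `y`
    let e := LinearEquiv.ofBijective
      (LinearMap.toSpanSingleton (R' ⊗[R] A) (R' ⊗[R] M) (bas i)) ⟨inj₁, surj₁⟩
    let φ : Module.End R' (R' ⊗[R] M) :=
      ((LinearMap.toSpanSingleton (R' ⊗[R] A) (R' ⊗[R] M) y).comp
        e.symm.toLinearMap).restrictScalars R'
    have hφi : φ (bas i) = y := by
      have : e.symm (bas i) = 1 := by
        rw [LinearEquiv.symm_apply_eq]
        exact (one_smul (R' ⊗[R] A) (bas i)).symm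
      change e.symm (bas i) • y = y
      rw [this, one_smul]
    have hφ (a) : Commute (baseChangeAction R' f a) φ := LinearMap.ext fun x =>
      (((LinearMap.toSpanSingleton (R' ⊗[R] A) (R' ⊗[R] M) y).comp
        e.symm.toLinearMap).map_smul a x).symm
    obtain ⟨r, hr, b, hb⟩ := ((LinearMap.toSpanSingleton (R' ⊗[R] A₂) (R' ⊗[R] M)
      (bas i)).restrictScalars R').exists_smul_mem_range_of_finrank_eq inj₂
        (by rw [rkA₂, rkM, hA₂]) hM' y
    -- Both sides commute with the first action and agree at the generator.
    have hb' : baseChangeAction R' f₂ b = r • φ := by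
      refine ext₁ _ _ (comm · b) (fun a => (hφ a).smul_right r) ?_
      rw [LinearMap.smul_apply, hφi]
      exact hb
    obtain ⟨c, hc⟩ := mem_range_baseChangeAction_of_smul_mem R' f₂ hsat hr ⟨b, hb'⟩
    refine ⟨c, ?_⟩
    change baseChangeAction R' f₂ c (bas i) = y
    rw [← hφi]
    exact LinearMap.congr_fun hc (bas i)
  exact Module.Free.of_equiv (LinearEquiv.ofBijective
    (LinearMap.toSpanSingleton (R' ⊗[R] A₂) (R' ⊗[R] M) (bas i)) ⟨inj₂, surj₂⟩)

end BaseChangeAction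

/-! ### Dimension and faithfulness of a Hopf-Galois structure -/

section HopfGalois

variable {K L H : Type*} [Field K] [Field L] [Algebra K L] [Ring H] [HopfAlgebra K H]
  [Module H L] [IsScalarTower K H L]

/-- Bijectivity of j gives [L:K] · dim H = [L:K]². -/
theorem IsHopfGalois.finrank_eq [FiniteDimensional K L] (h : IsHopfGalois K L H) :
    Module.finrank K H = Module.finrank K L := by
  have e := (LinearEquiv.ofBijective _ h.bijective).finrank_eq
  rw [Module.finrank_tensorProduct, Module.finrank_linearMap] at e
  exact Nat.eq_of_mul_eq_mul_left Module.finrank_pos e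

theorem IsHopfGalois.eq_zero_of_forall_smul_eq_zero (h : IsHopfGalois K L H) (a : H)
    (ha : ∀ x : L, a • x = 0) : a = 0 := by
  have h1 : (1 : L) ⊗ₜ[K] a = 0 := h.bijective.1 (LinearMap.ext fun x => by simp [ha])
  exact Algebra.TensorProduct.includeRight_injective (A := L) (B := H)
    (algebraMap K L).injective (by simpa using h1)

end HopfGalois

/-! ### The associated order as a full, saturated lattice -/

section AssociatedOrder

variable {R K L : Type*} {H : Type*} [CommRing R] [IsDomain R] [Field K] [Field L]
  [Algebra R K] [IsFractionRing R K] [Algebra K L] [Algebra R L] [IsScalarTower R K L]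
  [Ring H] [Algebra K H] [Algebra R H] [IsScalarTower R K H]
  [Module H L] [IsScalarTower K H L] {B : Submodule R L}

omit [IsDomain R] [IsFractionRing R K] in
include K in
theorem smul_smul_eq_of_isScalarTower (r : R) (h : H) (x : L) : (r • h) • x = r • h • x := by
  rw [← algebraMap_smul K r h, smul_assoc, algebraMap_smul]

omit [IsDomain R] [IsFractionRing R K] [Algebra R H] [IsScalarTower R K H] in
include K in
theorem smul_smul_comm_of_isScalarTower (r : R) (h : H) (x : L) : h • r • x = r • h • x := by
  have : SMulCommClass H K L := IsScalarTower.to_smulCommClass'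
  rw [← algebraMap_smul K r x, smul_comm, algebraMap_smul]

omit [IsFractionRing R K] in
/-- Every element of `H` has a nonzero `R`-multiple in the associated order of a finitely generated
full lattice. -/
theorem exists_smul_mem_associatedOrder (hB : ∀ x : L, ∃ r : R, r ≠ 0 ∧ r • x ∈ B)
    (hfg : B.FG) (h : H) : ∃ r : R, r ≠ 0 ∧ r • h ∈ associatedOrder R K H B := by
  classical
  obtain ⟨s, rfl⟩ := hfg
  choose c hc hcB using hB
  -- A common denominator for the images under h of the finitely many generators.
  refine ⟨∏ x ∈ s, c (h • x), Finset.prod_ne_zero_iff.mpr fun _ _ => hc _, fun x hx => ?_⟩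
  rw [smul_smul_eq_of_isScalarTower (K := K)]
  induction hx using Submodule.span_induction with
  | mem x hx =>
    rw [← Finset.prod_erase_mul s _ hx, mul_smul]
    exact Submodule.smul_mem _ _ (hcB _)
  | zero => simp
  | add x y _ _ hx hy => rw [smul_add, smul_add]; exact add_mem hx hy
  | smul r x _ hx =>
    rw [smul_smul_comm_of_isScalarTower (K := K), smul_comm]
    exact Submodule.smul_mem _ _ hx

theorem finrank_associatedOrder (hB : ∀ x : L, ∃ r : R, r ≠ 0 ∧ r • x ∈ B) (hfg : B.FG) :
    Module.finrank R (associatedOrder R K H B) = Module.finrank K H :=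
  (Subalgebra.toSubmodule (associatedOrder R K H B)).finrank_eq_of_forall_exists_smul_mem K
    (exists_smul_mem_associatedOrder (K := K) (H := H) hB hfg)

theorem associatedOrderAction_injective (hH : ∀ a : H, (∀ x : L, a • x = 0) → a = 0)
    (hB : ∀ x : L, ∃ r : R, r ≠ 0 ∧ r • x ∈ B) :
    Function.Injective (associatedOrderAction R K H B) := by
  rw [injective_iff_map_eq_zero]
  intro a ha
  refine Subtype.ext (hH _ fun x => ?_)
  obtain ⟨r, hr, hx⟩ := hB x
  have h0 : (a : H) • r • x = 0 := congrArg Subtype.val (LinearMap.congr_fun ha ⟨r • x, hx⟩)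
  rw [smul_smul_comm_of_isScalarTower (K := K), ← algebraMap_smul K r] at h0
  exact (smul_eq_zero.mp h0).resolve_left
    (IsFractionRing.to_map_ne_zero_of_mem_nonZeroDivisors (mem_nonZeroDivisors_of_ne_zero hr))

/-- If a acts as r • φ, then r⁻¹a ∈ H acts on B as φ, so it preserves B and lies in the associated
order. -/
theorem mem_range_associatedOrderAction_of_smul_mem (r : R) (φ : Module.End R B) (hr : r ≠ 0)
    (h : r • φ ∈ (associatedOrderAction R K H B).range) :
    φ ∈ (associatedOrderAction R K H B).range := by
  obtain ⟨a, ha⟩ := h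
  have hr' : algebraMap R K r ≠ 0 :=
    IsFractionRing.to_map_ne_zero_of_mem_nonZeroDivisors (mem_nonZeroDivisors_of_ne_zero hr)
  have key (x : B) : ((algebraMap R K r)⁻¹ • (a : H)) • (x : L) = φ x := by
    have h1 : (a : H) • (x : L) = r • (φ x : L) := congrArg Subtype.val (LinearMap.congr_fun ha x)
    rw [smul_assoc, h1, ← algebraMap_smul K r, inv_smul_smul₀ hr']
  exact ⟨⟨(algebraMap R K r)⁻¹ • (a : H), fun x hx => key ⟨x, hx⟩ ▸ (φ ⟨x, hx⟩).2⟩,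
    LinearMap.ext fun x => Subtype.ext (key x)⟩

end AssociatedOrder

theorem IsLocallyFreeOverAssociatedOrder.of_commute
    {R K L H₁ H₂ : Type*} [CommRing R] [IsDedekindDomain R] [Field K] [Field L]
    [Algebra R K] [IsFractionRing R K] [Algebra K L] [FiniteDimensional K L]
    [Algebra R L] [IsScalarTower R K L]
    [Ring H₁] [HopfAlgebra K H₁] [Module H₁ L] [IsScalarTower K H₁ L]
    [Ring H₂] [HopfAlgebra K H₂] [Module H₂ L] [IsScalarTower K H₂ L]
    (hH₁ : IsHopfGalois K L H₁) (hH₂ : IsHopfGalois K L H₂)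
    (hcomm : ∀ (h₁ : H₁) (h₂ : H₂) (x : L), h₁ • (h₂ • x) = h₂ • (h₁ • x))
    [Algebra R H₁] [IsScalarTower R K H₁] [Algebra R H₂] [IsScalarTower R K H₂]
    {B : Submodule R L} (hB : ∀ x : L, ∃ r : R, r ≠ 0 ∧ r • x ∈ B) (hfg : B.FG)
    (h : IsLocallyFreeOverAssociatedOrder R K H₁ B) :
    IsLocallyFreeOverAssociatedOrder R K H₂ B := by
  intro p
  have : Module.Finite R B := Module.Finite.iff_fg.mpr hfg
  have : Module.FinitePresentation R B := Module.finitePresentation_of_finite R B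
  have hrk : Module.finrank R B = Module.finrank K L :=
    B.finrank_eq_of_forall_exists_smul_mem K hB
  exact IsFreeAfterBaseChange.of_commute _
    (f := associatedOrderAction R K H₁ B) (f₂ := associatedOrderAction R K H₂ B)
    (fun a b => LinearMap.ext fun x => Subtype.ext (hcomm a b x))
    (associatedOrderAction_injective hH₂.eq_zero_of_forall_smul_eq_zero hB) mem_range_associatedOrderAction_of_smul_mem
    (by rw [finrank_associatedOrder (K := K) (H := H₁) hB hfg, hrk, hH₁.finrank_eq])
    (by rw [finrank_associatedOrder (K := K) (H := H₂) hB hfg, hrk, hH₂.finrank_eq])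
    (by rw [hrk]; exact Module.finrank_pos) (h p)

theorem IsFreeAfterBaseChange.of_subsingleton {R : Type*} [CommRing R] (R' : Type*) [CommRing R']
    [Algebra R R'] {A : Type*} [Ring A] [Algebra R A] {M : Type*} [AddCommGroup M] [Module R M]
    [Subsingleton M] (f : A →ₐ[R] Module.End R M) : IsFreeAfterBaseChange R' f := by
  have : Subsingleton (R' ⊗[R] M) := inferInstance
  let m : Module (R' ⊗[R] A) (R' ⊗[R] M) :=
    Module.compHom (R' ⊗[R] M) (baseChangeAction R' f).toRingHom
  exact Module.Free.of_subsingleton (R' ⊗[R] A) (R' ⊗[R] M)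

/-! ### Nonzero fractional ideals are finitely generated full lattices -/

section FractionalIdeal

variable (R K : Type*) {L S : Type*} [CommRing R] [Field K] [Field L]
  [Algebra R K] [IsFractionRing R K] [Algebra K L] [FiniteDimensional K L]
  [CommRing S] [Algebra R S] [Algebra S L] [Algebra R L]
  [IsScalarTower R K L] [IsScalarTower R S L] [IsIntegralClosure S R L]

include K in
theorem FractionalIdeal.fg_restrictScalars [IsDedekindDomain R] [Algebra.IsSeparable K L]
    (B : FractionalIdeal S⁰ L) : ((B : Submodule S L).restrictScalars R).FG := by
  have := IsIntegralClosure.finite R K L S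
  have := IsIntegralClosure.isNoetherianRing R K L S
  have : IsDomain S := (IsIntegralClosure.algebraMap_injective S R L).isDomain
  have : FaithfulSMul S L :=
    (faithfulSMul_iff_algebraMap_injective S L).mpr (IsIntegralClosure.algebraMap_injective S R L)
  exact (FractionalIdeal.fg_of_isNoetherianRing le_rfl B).restrictScalars

include K in
theorem FractionalIdeal.exists_smul_mem_restrictScalars [IsDomain R]
    (B : FractionalIdeal S⁰ L) (hB : (B : Submodule S L) ≠ ⊥) (x : L) :
    ∃ r : R, r ≠ 0 ∧ r • x ∈ (B : Submodule S L).restrictScalars R := by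
  have := IsIntegralClosure.isLocalization R K L S
  obtain ⟨b, hb, hb0⟩ := Submodule.exists_mem_ne_zero_of_ne_bot hB
  -- Elements of L have denominators in R: write x / b = s / r, so that r • x = s • b ∈ B.
  obtain ⟨⟨s, ⟨_, r, hr, rfl⟩⟩, hs⟩ :=
    IsLocalization.surj (Algebra.algebraMapSubmonoid S R⁰) (x / b)
  refine ⟨r, nonZeroDivisors.ne_zero hr, ?_⟩
  have : r • x = s • b := by
    simp only [← IsScalarTower.algebraMap_apply] at hs
    rw [Algebra.smul_def, Algebra.smul_def, ← hs]
    field_simp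
  rw [this]
  exact (B : Submodule S L).smul_mem s hb

end FractionalIdeal

theorem mainTheorem6
    {K L : Type*} [Field K] [Field L] [Algebra K L]
    [FiniteDimensional K L] [Algebra.IsSeparable K L] (hK : IsGlobalField K)
    -- rings of integers `R` of `K` and `S` of `L`
    {R S : Type*} [CommRing R] [IsDedekindDomain R] [Algebra R K] [IsFractionRing R K]
    [CommRing S] [Algebra R S] [Algebra S L] [Algebra R L]
    [IsScalarTower R K L] [IsScalarTower R S L] [IsIntegralClosure S R L]
    -- Hopf algebras giving Hopf-Galois structures on `L / K` whose actions commute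
    {H₁ H₂ : Type*}
    [Ring H₁] [HopfAlgebra K H₁] [Module H₁ L] [IsScalarTower K H₁ L]
    [Ring H₂] [HopfAlgebra K H₂] [Module H₂ L] [IsScalarTower K H₂ L]
    (hH₁ : IsHopfGalois K L H₁) (hH₂ : IsHopfGalois K L H₂)
    (hcomm : ∀ (h₁ : H₁) (h₂ : H₂) (x : L), h₁ • (h₂ • x) = h₂ • (h₁ • x))
    [Algebra R H₁] [IsScalarTower R K H₁] [Algebra R H₂] [IsScalarTower R K H₂]
    (B : FractionalIdeal S⁰ L) :
    IsLocallyFreeOverAssociatedOrder R K H₁ ((B : Submodule S L).restrictScalars R) ↔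
      IsLocallyFreeOverAssociatedOrder R K H₂ ((B : Submodule S L).restrictScalars R) := by
  -- The zero ideal is allowed; it is not a full lattice, but the zero module is free over any ring.
  by_cases hB : (B : Submodule S L) = ⊥
  · have : Subsingleton ((B : Submodule S L).restrictScalars R) := by
      rw [hB]
      exact inferInstanceAs (Subsingleton (⊥ : Submodule S L))
    exact iff_of_true (fun p => .of_subsingleton _ _) (fun p => .of_subsingleton _ _)
  · have hfg := B.fg_restrictScalars R K
    have hfull := B.exists_smul_mem_restrictScalars R K hB
    exact ⟨.of_commute hH₁ hH₂ hcomm hfull hfg,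
      .of_commute hH₂ hH₁ (fun h₂ h₁ x => (hcomm h₁ h₂ x).symm) hfull hfg⟩
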